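/- Let $M$ be a finite-dimensional smooth manifold without boundary with an almost contact metric structure $(\varphi,\xi,\eta,g)$: a smooth Riemannian metric $g$, a smooth $(1,1)$-tensor field $\varphi$, a smooth vector field $\xi$ and a smooth $1$-form $\eta$ such that $\varphi^2=-I+\eta\otimes\xi$, $\eta(\xi)=1$ and $g(\varphi X,\varphi Y)=g(X,Y)-\eta(X)\eta(Y)$. Let $\widetilde M=\mathbf R_+\times M$ be the metric cone over $M$, with metric $\widetilde g=dt^2+t^2g$ (where $t>0$ is the coordinate of $\mathbf R_+$) and with the almost complex structure $J$ given by $$J\partial_t=-\tfrac1t\,\xi,\qquad JX=\varphi X+t\,\eta(X)\,\partial_t\quad (X \text{ tangent to } M),$$ which is compatible with $\widetilde g$. For a Riemannian metric $g$ with Levi-Civita connection $\nabla$ put $R_{XY}Z=\nabla_X\nabla_YZ-\nabla_Y\nabla_XZ-\nabla_{[X,Y]}Z$ and $R(X,Y,Z,W)=-g(R_{XY}Z,W)$; let $R$ and $\widetilde R$ be the tensors so obtained from $g$ on $M$ and from $\widetilde g$ on $\widetilde M$. Then $(\widetilde M,J,\widetilde g)$ satisfies Gray's identity $$(K2)\qquad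 \widetilde R(A,B,C,D)=\widetilde R(JA,JB,C,D)+\widetilde R(JA,B,JC,D)+\widetilde R(JA,B,C,JD)$$ for all $A,B,C,D$ tangent to $\widetilde M$ if and only if $M$ satisfies the identity $$(G2)\qquad R(X,Y,Z,W)=R(\varphi X,Y,Z,\varphi W)+R(X,\varphi Y,Z,\varphi W)+R(X,Y,\varphi Z,\varphi W)+g(X,Z)\eta(W)\eta(Y)-g(Z,Y)\eta(X)\eta(W)$$ for all $X,Y,Z,W$ tangent to $M$. -/

import Mathlib

open Bundle
open scoped Manifold ContDiff

set_option linter.unusedSectionVars false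

noncomputable section

section LocalGeometry

variable {E : Type*} [NormedAddCommGroup E] [NormedSpace ℝ E]

/-- The Christoffel symbols `Γ_y(u, v)` of a metric `G` given on an open set of the vector space
`E`: `Γ_y(u, v)` is the vector with
`G_y(Γ_y(u, v), w) = (1/2) (∂_u G_y(v, w) + ∂_v G_y(u, w) - ∂_w G_y(u, v))` for all `w`. -/
def christoffel (G : E → E →L[ℝ] E →L[ℝ] ℝ) (y u v : E) : E :=
  (G y).inverse ((1 / 2 : ℝ) •
    (fderiv ℝ G y u v + fderiv ℝ G y v u - ((fderiv ℝ G y).flip u).flip v))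

/-- The Levi-Civita connection `∇_X Y = D_X Y + Γ(X, Y)` of a metric `G` in a coordinate domain. -/
def localLeviCivita (G : E → E →L[ℝ] E →L[ℝ] ℝ) (X Y : E → E) : E → E :=
  fun y => fderiv ℝ Y y (X y) + christoffel G y (X y) (Y y)

/-- The curvature `R_{XY} Z = ∇_X ∇_Y Z - ∇_Y ∇_X Z - ∇_{[X,Y]} Z` in a coordinate domain. -/
def localCurvature (G : E → E →L[ℝ] E →L[ℝ] ℝ) (X Y Z : E → E) : E → E :=
  localLeviCivita G X (localLeviCivita G Y Z) - localLeviCivita G Y (localLeviCivita G X Z)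
    - localLeviCivita G (VectorField.lieBracket ℝ X Y) Z

end LocalGeometry

section Manifold

variable {E : Type*} [NormedAddCommGroup E] [NormedSpace ℝ E]
  {H : Type*} [TopologicalSpace H] (I : ModelWithCorners ℝ E H)
  (M : Type*) [TopologicalSpace M] [ChartedSpace H M] [IsManifold I ∞ M]

/-- Smooth Riemannian metrics on the manifold `M`. -/
abbrev RiemannianMetricOn :=
  ContMDiffRiemannianMetric I ∞ E (fun x : M => TangentSpace I x)

variable {I M}

/-- The expression of the metric `g` in the chart of `M` around `x`: its pullback under the
inverse of this chart. -/
def metricInChart (g : RiemannianMetricOn I M) (x : M) (y : E) : E →L[ℝ] E →L[ℝ] ℝ :=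
  ContinuousLinearMap.bilinearComp (E := E) (F := E)
    (g.inner ((extChartAt I x).symm y))
    (mfderiv 𝓘(ℝ, E) I (extChartAt I x).symm y)
    (mfderiv 𝓘(ℝ, E) I (extChartAt I x).symm y)

/-- The curvature tensor `R_{uv} w` at `x`, computed in the chart around `x`, extending tangent
vectors at `x` by the fields with constant components. (The differential at `x` of the chart
around `x` is the identity of `TangentSpace I x = E`.) -/
def curvature (g : RiemannianMetricOn I M) (x : M) (u v w : TangentSpace I x) :
    TangentSpace I x :=
  localCurvature (E := E) (metricInChart g x) (fun _ => u) (fun _ => v) (fun _ => w)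
    (extChartAt I x x)

/-- The Riemann-Christoffel curvature tensor `R(u, v, w, z) = -g(R_{uv} w, z)`. -/
def riemannChristoffel (g : RiemannianMetricOn I M) (x : M) (u v w z : TangentSpace I x) : ℝ :=
  -g.inner x (curvature g x u v w) z

variable (I M)

/-- An almost Hermitian structure `(J, g)` on `M`. -/
structure AlmostHermitianStructure where
  g : RiemannianMetricOn I M
  J (x : M) : TangentSpace I x →L[ℝ] TangentSpace I x
  contMDiff_J : ContMDiff I (I.prod 𝓘(ℝ, E →L[ℝ] E)) ∞
    (fun x => TotalSpace.mk' (E →L[ℝ] E)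
      (E := fun x : M => TangentSpace I x →L[ℝ] TangentSpace I x) x (J x))
  J_J (x : M) (u : TangentSpace I x) : J x (J x u) = -u
  g_J_J (x : M) (u v : TangentSpace I x) : g.inner x (J x u) (J x v) = g.inner x u v

/-- An almost contact metric structure `(φ, ξ, η, g)` on `M`. -/
structure AlmostContactMetricStructure where
  g : RiemannianMetricOn I M
  φ (x : M) : TangentSpace I x →L[ℝ] TangentSpace I x
  ξ (x : M) : TangentSpace I x
  η (x : M) : TangentSpace I x →L[ℝ] ℝ
  contMDiff_φ : ContMDiff I (I.prod 𝓘(ℝ, E →L[ℝ] E)) ∞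
    (fun x => TotalSpace.mk' (E →L[ℝ] E)
      (E := fun x : M => TangentSpace I x →L[ℝ] TangentSpace I x) x (φ x))
  contMDiff_ξ : ContMDiff I (I.prod 𝓘(ℝ, E)) ∞
    (fun x => TotalSpace.mk' E (E := fun x : M => TangentSpace I x) x (ξ x))
  contMDiff_η : ContMDiff I (I.prod 𝓘(ℝ, E →L[ℝ] ℝ)) ∞
    (fun x => TotalSpace.mk' (E →L[ℝ] ℝ)
      (E := fun x : M => TangentSpace I x →L[ℝ] ℝ) x (η x))
  η_ξ (x : M) : η x (ξ x) = 1
  φ_φ (x : M) (u : TangentSpace I x) : φ x (φ x u) = -u + η x u • ξ x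
  g_φ_φ (x : M) (u v : TangentSpace I x) :
    g.inner x (φ x u) (φ x v) = g.inner x u v - η x u * η x v

variable {I M}

/-- Gray's curvature identity `(K2)` for an almost Hermitian manifold. -/
def AlmostHermitianStructure.IsK2 (S : AlmostHermitianStructure I M) : Prop :=
  ∀ (x : M) (X Y Z W : TangentSpace I x),
    riemannChristoffel S.g x X Y Z W =
      riemannChristoffel S.g x (S.J x X) (S.J x Y) Z W
        + riemannChristoffel S.g x (S.J x X) Y (S.J x Z) W
        + riemannChristoffel S.g x (S.J x X) Y Z (S.J x W)

/-- The curvature identity `(G2)` for an almost contact metric manifold. -/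
def AlmostContactMetricStructure.IsG2 (S : AlmostContactMetricStructure I M) : Prop :=
  ∀ (x : M) (X Y Z W : TangentSpace I x),
    riemannChristoffel S.g x X Y Z W =
      riemannChristoffel S.g x (S.φ x X) Y Z (S.φ x W)
        + riemannChristoffel S.g x X (S.φ x Y) Z (S.φ x W)
        + riemannChristoffel S.g x X Y (S.φ x Z) (S.φ x W)
        + S.g.inner x X Z * S.η x W * S.η x Y
        - S.g.inner x Z Y * S.η x X * S.η x W

end Manifold

section Cone

/-- The open half-line `ℝ₊ = (0, ∞)`. -/
def PosReal : TopologicalSpace.Opens ℝ := ⟨Set.Ioi 0, isOpen_Ioi⟩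

/-- The manifold `ℝ₊ × M` underlying the metric cone over `M`. Its tangent space at `(t, x)` is
`ℝ × TangentSpace I x`, with `∂_t = (1, 0)`. -/
abbrev ConeManifold (M : Type*) := PosReal × M

variable {E : Type*} [NormedAddCommGroup E] [NormedSpace ℝ E]
  {H : Type*} [TopologicalSpace H] {I : ModelWithCorners ℝ E H}
  {M : Type*} [TopologicalSpace M] [ChartedSpace H M] [IsManifold I ∞ M]

variable (I) in
/-- The form `dt` on the cone. -/
def coneDt (p : ConeManifold M) : TangentSpace (𝓘(ℝ, ℝ).prod I) p →L[ℝ] ℝ :=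
  ContinuousLinearMap.fst ℝ ℝ E

variable (I) in
/-- The projection of a tangent vector of the cone to `M`. -/
def coneProj (p : ConeManifold M) :
    TangentSpace (𝓘(ℝ, ℝ).prod I) p →L[ℝ] TangentSpace I p.2 :=
  ContinuousLinearMap.snd ℝ ℝ E

/-- The bilinear form `dt² + c b` on `ℝ × E`. -/
def coneForm (c : ℝ) (b : E →L[ℝ] E →L[ℝ] ℝ) : ℝ × E →L[ℝ] ℝ × E →L[ℝ] ℝ :=
  (ContinuousLinearMap.fst ℝ ℝ E).smulRight (ContinuousLinearMap.fst ℝ ℝ E)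
    + c • b.bilinearComp (ContinuousLinearMap.snd ℝ ℝ E) (ContinuousLinearMap.snd ℝ ℝ E)

/-- The endomorphism `(a, X) ↦ (t η(X), φ X - (a / t) ξ)` of `ℝ × E`. -/
def coneEndo (t : ℝ) (φ : E →L[ℝ] E) (ξ : E) (η : E →L[ℝ] ℝ) : ℝ × E →L[ℝ] ℝ × E :=
  (t • η.comp (ContinuousLinearMap.snd ℝ ℝ E)).prod
    (φ.comp (ContinuousLinearMap.snd ℝ ℝ E)
      - t⁻¹ • (ContinuousLinearMap.fst ℝ ℝ E).smulRight ξ)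

/-- The bilinear form `dt² + t² g` on the tangent spaces of the cone. -/
def coneInner (g : RiemannianMetricOn I M) (p : ConeManifold M) :
    TangentSpace (𝓘(ℝ, ℝ).prod I) p →L[ℝ] TangentSpace (𝓘(ℝ, ℝ).prod I) p →L[ℝ] ℝ :=
  coneForm (E := E) ((p.1 : ℝ) ^ 2) (g.inner p.2)

/-- The endomorphism `J (a, X) = (t η(X), φ X - (a / t) ξ)` of the tangent spaces of the cone. -/
def coneJ (S : AlmostContactMetricStructure I M) (p : ConeManifold M) :
    TangentSpace (𝓘(ℝ, ℝ).prod I) p →L[ℝ] TangentSpace (𝓘(ℝ, ℝ).prod I) p :=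
  coneEndo (E := E) (p.1 : ℝ) (S.φ p.2) (S.ξ p.2) (S.η p.2)

lemma PosReal.pos (t : PosReal) : 0 < (t : ℝ) := t.2

lemma coneInner_apply (g : RiemannianMetricOn I M) (p : ConeManifold M)
    (u v : TangentSpace (𝓘(ℝ, ℝ).prod I) p) :
    coneInner g p u v = coneDt I p u * coneDt I p v
      + (p.1 : ℝ) ^ 2 * g.inner p.2 (coneProj I p u) (coneProj I p v) := by
  rfl

lemma coneDt_coneJ (S : AlmostContactMetricStructure I M) (p : ConeManifold M)
    (u : TangentSpace (𝓘(ℝ, ℝ).prod I) p) :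
    coneDt I p (coneJ S p u) = (p.1 : ℝ) * S.η p.2 (coneProj I p u) := by
  rfl

lemma coneProj_coneJ (S : AlmostContactMetricStructure I M) (p : ConeManifold M)
    (u : TangentSpace (𝓘(ℝ, ℝ).prod I) p) :
    coneProj I p (coneJ S p u)
      = S.φ p.2 (coneProj I p u) - (p.1 : ℝ)⁻¹ • coneDt I p u • S.ξ p.2 := by
  rfl

lemma cone_ext {p : ConeManifold M} {u v : TangentSpace (𝓘(ℝ, ℝ).prod I) p}
    (h₁ : coneDt I p u = coneDt I p v) (h₂ : coneProj I p u = coneProj I p v) : u = v :=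
  Prod.ext h₁ h₂

namespace AlmostContactMetricStructure

lemma φ_ξ (S : AlmostContactMetricStructure I M) (x : M) : S.φ x (S.ξ x) = 0 := by
  have h1 : S.φ x (S.φ x (S.ξ x)) = 0 := by rw [S.φ_φ, S.η_ξ]; simp
  have h2 := S.φ_φ x (S.φ x (S.ξ x))
  rw [h1, map_zero] at h2
  have h3 : S.φ x (S.ξ x) = S.η x (S.φ x (S.ξ x)) • S.ξ x := by
    rw [eq_comm, neg_add_eq_zero] at h2
    exact h2
  generalize S.η x (S.φ x (S.ξ x)) = c at h3
  rw [h3, map_smul, h3, smul_smul] at h1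
  have h4 := congrArg (S.η x) h1
  rw [map_smul, S.η_ξ, map_zero, smul_eq_mul, mul_one, mul_self_eq_zero] at h4
  rw [h3, h4, zero_smul]

lemma η_φ (S : AlmostContactMetricStructure I M) (x : M) (u : TangentSpace I x) :
    S.η x (S.φ x u) = 0 := by
  have h1 := S.φ_φ x (S.φ x u)
  have h0 : S.φ x (S.φ x (S.φ x u)) = -S.φ x u := by
    rw [S.φ_φ x u, map_add, map_smul, S.φ_ξ, smul_zero, add_zero, map_neg]
  rw [h0] at h1
  have h2 : S.η x (S.φ x u) • S.ξ x = 0 := by simpa using h1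
  have h3 := congrArg (S.η x) h2
  simpa [S.η_ξ] using h3

lemma g_ξ (S : AlmostContactMetricStructure I M) (x : M) (u : TangentSpace I x) :
    S.g.inner x u (S.ξ x) = S.η x u := by
  have h := S.g_φ_φ x u (S.ξ x)
  rw [S.φ_ξ, S.η_ξ] at h
  simp at h
  linarith

end AlmostContactMetricStructure

lemma posReal_extChartAt_symm (t₀ : PosReal) {y : ℝ} (hy : 0 < y) :
    (((extChartAt 𝓘(ℝ, ℝ) t₀).symm y : PosReal) : ℝ) = y := by
  have hy' : y ∈ ((chartAt ℝ (t₀ : ℝ)).subtypeRestr ⟨t₀⟩).target := by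
    have h := ((chartAt ℝ (t₀ : ℝ)).subtypeRestr ⟨t₀⟩).map_source (x := (⟨y, hy⟩ : PosReal))
      (by simp [chartAt_self_eq])
    exact h
  exact ((chartAt ℝ (t₀ : ℝ)).subtypeRestr_symm_eqOn ⟨t₀⟩ hy').symm

lemma mfderiv_extChartAt_posReal (t₀ t : PosReal) :
    mfderiv 𝓘(ℝ, ℝ) 𝓘(ℝ, ℝ) (extChartAt 𝓘(ℝ, ℝ) t₀) t = ContinuousLinearMap.id ℝ ℝ := by
  have h : (extChartAt 𝓘(ℝ, ℝ) t₀ : PosReal → ℝ) = extChartAt 𝓘(ℝ, ℝ) t := by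
    ext s
    rfl
  rw [h]
  exact mfderiv_extChartAt_self

lemma cone_continuousLinearMapAt (p₀ p : ConeManifold M)
    (hp : p.2 ∈ (chartAt H p₀.2).source) (v : ℝ × E) :
    (trivializationAt (ℝ × E) (TangentSpace (𝓘(ℝ, ℝ).prod I)) p₀).continuousLinearMapAt ℝ p v
      = (v.1, (trivializationAt E (TangentSpace I) p₀.2).continuousLinearMapAt ℝ p.2 v.2) := by
  have h1 : p.1 ∈ (chartAt ℝ p₀.1).source := by
    simp [TopologicalSpace.Opens.chartAt_eq, chartAt_self_eq]
  have hs : p ∈ (chartAt (ModelProd ℝ H) p₀).source := by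
    rw [prodChartedSpace_chartAt]
    exact ⟨h1, hp⟩
  rw [TangentBundle.continuousLinearMapAt_trivializationAt hs,
    TangentBundle.continuousLinearMapAt_trivializationAt hp]
  have h2 : (extChartAt (𝓘(ℝ, ℝ).prod I) p₀ : ConeManifold M → ℝ × E)
      = Prod.map (extChartAt 𝓘(ℝ, ℝ) p₀.1) (extChartAt I p₀.2) := by
    rw [extChartAt_prod]
    rfl
  rw [h2, modelWithCornersSelf_prod, ← chartedSpaceSelf_prod]
  have h3 := mfderiv_prodMap (p := p) (mdifferentiableAt_extChartAt (I := 𝓘(ℝ, ℝ)) h1)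
    (mdifferentiableAt_extChartAt (I := I) hp)
  rw [mfderiv_extChartAt_posReal] at h3
  have h4 : ∀ L : E →L[ℝ] E, (ContinuousLinearMap.id ℝ ℝ).prodMap L v = (v.1, L v.2) :=
    fun _ => rfl
  exact (congrFun (congrArg DFunLike.coe h3) v).trans
    (h4 (mfderiv I 𝓘(ℝ, E) (extChartAt I p₀.2) p.2))

lemma cone_symmL (p₀ p : ConeManifold M)
    (hp : p.2 ∈ (chartAt H p₀.2).source) (v : ℝ × E) :
    (trivializationAt (ℝ × E) (TangentSpace (𝓘(ℝ, ℝ).prod I)) p₀).symmL ℝ p v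
      = (v.1, (trivializationAt E (TangentSpace I) p₀.2).symmL ℝ p.2 v.2) := by
  have h1 : p.1 ∈ (chartAt ℝ p₀.1).source := by
    simp [TopologicalSpace.Opens.chartAt_eq, chartAt_self_eq]
  have hs : p ∈ (trivializationAt (ℝ × E) (TangentSpace (𝓘(ℝ, ℝ).prod I)) p₀).baseSet := by
    rw [TangentBundle.trivializationAt_baseSet, prodChartedSpace_chartAt]
    exact ⟨h1, hp⟩
  have hs' : p.2 ∈ (trivializationAt E (TangentSpace I) p₀.2).baseSet := by
    rwa [TangentBundle.trivializationAt_baseSet]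
  set e := trivializationAt (ℝ × E) (TangentSpace (𝓘(ℝ, ℝ).prod I)) p₀
  have h2 := cone_continuousLinearMapAt (I := I) p₀ p hp
    ((v.1, (trivializationAt E (TangentSpace I) p₀.2).symmL ℝ p.2 v.2) : ℝ × E)
  have h3 := (trivializationAt E (TangentSpace I) p₀.2).continuousLinearMapAt_symmL
    (R := ℝ) hs' v.2
  have h4 := e.symmL_continuousLinearMapAt (R := ℝ) hs
    ((v.1, (trivializationAt E (TangentSpace I) p₀.2).symmL ℝ p.2 v.2) : ℝ × E)
  have h5 : ((v.1, (trivializationAt E (TangentSpace I) p₀.2).continuousLinearMapAt ℝ p.2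
      ((trivializationAt E (TangentSpace I) p₀.2).symmL ℝ p.2 v.2)) : ℝ × E) = v :=
    Prod.ext rfl h3
  exact (congrArg (e.symmL ℝ p) (h2.trans h5).symm).trans h4

lemma cone_chart_mem_nhds (p₀ : ConeManifold M) :
    ∀ᶠ p in nhds p₀, p.2 ∈ (chartAt H p₀.2).source :=
  continuousAt_snd.eventually (chart_source_mem_nhds H p₀.2)

lemma cone_mem_baseSet {p₀ p : ConeManifold M} (hp : p.2 ∈ (chartAt H p₀.2).source) :
    p ∈ (trivializationAt (ℝ × E) (TangentSpace (𝓘(ℝ, ℝ).prod I)) p₀).baseSet ∧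
      p.2 ∈ (trivializationAt E (TangentSpace I) p₀.2).baseSet := by
  have h1 : p.1 ∈ (chartAt ℝ p₀.1).source := by
    simp [TopologicalSpace.Opens.chartAt_eq, chartAt_self_eq]
  rw [TangentBundle.trivializationAt_baseSet, TangentBundle.trivializationAt_baseSet,
    prodChartedSpace_chartAt]
  exact ⟨⟨h1, hp⟩, hp⟩

lemma contMDiffAt_coneT {p₀ : ConeManifold M} :
    ContMDiffAt (𝓘(ℝ, ℝ).prod I) 𝓘(ℝ, ℝ) ∞ (fun p : ConeManifold M => (p.1 : ℝ)) p₀ :=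
  (contMDiff_subtype_val.comp contMDiff_fst).contMDiffAt

lemma contMDiffAt_coneForm {c : ConeManifold M → ℝ} {b : ConeManifold M → E →L[ℝ] E →L[ℝ] ℝ}
    {p₀ : ConeManifold M} (hc : ContMDiffAt (𝓘(ℝ, ℝ).prod I) 𝓘(ℝ, ℝ) ∞ c p₀)
    (hb : ContMDiffAt (𝓘(ℝ, ℝ).prod I) 𝓘(ℝ, E →L[ℝ] E →L[ℝ] ℝ) ∞ b p₀) :
    ContMDiffAt (𝓘(ℝ, ℝ).prod I) 𝓘(ℝ, ℝ × E →L[ℝ] ℝ × E →L[ℝ] ℝ) ∞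
      (fun p => coneForm (c p) (b p)) p₀ := by
  have h : ContDiff ℝ ∞ (fun q : ℝ × (E →L[ℝ] E →L[ℝ] ℝ) => coneForm q.1 q.2) := by
    have h1 : (fun q : ℝ × (E →L[ℝ] E →L[ℝ] ℝ) => coneForm q.1 q.2) = fun q =>
        (ContinuousLinearMap.fst ℝ ℝ E).smulRight (ContinuousLinearMap.fst ℝ ℝ E)
          + ((ContinuousLinearMap.precomp ℝ (ContinuousLinearMap.snd ℝ ℝ E)).comp
            (q.1 • q.2)).comp (ContinuousLinearMap.snd ℝ ℝ E) := by
      ext q v w <;> rfl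
    rw [h1]
    have h2 : ContDiff ℝ ∞ (fun q : ℝ × (E →L[ℝ] E →L[ℝ] ℝ) =>
        ((ContinuousLinearMap.precomp ℝ (ContinuousLinearMap.snd ℝ ℝ E)).comp
            (q.1 • q.2)).comp (ContinuousLinearMap.snd ℝ ℝ E)) :=
      (contDiff_const.clm_comp (contDiff_fst.smul contDiff_snd)).clm_comp contDiff_const
    exact contDiff_const.add h2
  exact h.contDiffAt.comp_contMDiffAt (hc.prodMk_space hb)

lemma contMDiffAt_coneEndo {t : ConeManifold M → ℝ} {φ : ConeManifold M → E →L[ℝ] E}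
    {ξ : ConeManifold M → E} {η : ConeManifold M → E →L[ℝ] ℝ} {p₀ : ConeManifold M}
    (ht : ContMDiffAt (𝓘(ℝ, ℝ).prod I) 𝓘(ℝ, ℝ) ∞ t p₀) (ht₀ : t p₀ ≠ 0)
    (hφ : ContMDiffAt (𝓘(ℝ, ℝ).prod I) 𝓘(ℝ, E →L[ℝ] E) ∞ φ p₀)
    (hξ : ContMDiffAt (𝓘(ℝ, ℝ).prod I) 𝓘(ℝ, E) ∞ ξ p₀)
    (hη : ContMDiffAt (𝓘(ℝ, ℝ).prod I) 𝓘(ℝ, E →L[ℝ] ℝ) ∞ η p₀) :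
    ContMDiffAt (𝓘(ℝ, ℝ).prod I) 𝓘(ℝ, ℝ × E →L[ℝ] ℝ × E) ∞
      (fun p => coneEndo (t p) (φ p) (ξ p) (η p)) p₀ := by
  have h : ContDiffAt ℝ ∞ (fun q : ℝ × (E →L[ℝ] E) × E × (E →L[ℝ] ℝ) =>
      coneEndo q.1 q.2.1 q.2.2.1 q.2.2.2) (t p₀, φ p₀, ξ p₀, η p₀) := by
    have h1 : (fun q : ℝ × (E →L[ℝ] E) × E × (E →L[ℝ] ℝ) =>
        coneEndo q.1 q.2.1 q.2.2.1 q.2.2.2) = fun q =>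
        (ContinuousLinearMap.inl ℝ ℝ E).comp
            (q.1 • q.2.2.2.comp (ContinuousLinearMap.snd ℝ ℝ E))
          + (ContinuousLinearMap.inr ℝ ℝ E).comp
            (q.2.1.comp (ContinuousLinearMap.snd ℝ ℝ E)
              - q.1⁻¹ • (ContinuousLinearMap.fst ℝ ℝ E).smulRight q.2.2.1) := by
      funext q
      ext v <;> simp [coneEndo]
    rw [h1]
    have hq : ContDiffAt ℝ ∞ (fun q : ℝ × (E →L[ℝ] E) × E × (E →L[ℝ] ℝ) => q.1⁻¹)
        (t p₀, φ p₀, ξ p₀, η p₀) := contDiffAt_fst.inv ht₀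
    have hr : ContDiff ℝ ∞ (fun q : ℝ × (E →L[ℝ] E) × E × (E →L[ℝ] ℝ) =>
        (ContinuousLinearMap.fst ℝ ℝ E).smulRight q.2.2.1) := by
      exact contDiff_const.smulRight (contDiff_fst.comp (contDiff_snd.comp contDiff_snd))
    fun_prop
  exact ContDiffAt.comp_contMDiffAt (f := fun p => (t p, φ p, ξ p, η p)) h (ht.prodMk_space (hφ.prodMk_space (hξ.prodMk_space hη)))

lemma clm_apply_smul_smul (b : E →L[ℝ] E →L[ℝ] ℝ) (t : ℝ) (v : E) :
    b (t • v) (t • v) = t ^ 2 * b v v := by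
  simp only [map_smul, smul_apply, smul_eq_mul]
  ring

lemma clm_apply_self_of_eq_zero (b : E →L[ℝ] E →L[ℝ] ℝ) {v : E} (h : v = 0) : b v v = 0 := by
  rw [h, map_zero]

lemma linearMapAt_trivial_real {B : Type*} [TopologicalSpace B] (b₀ b : B) (a : ℝ) :
    (trivializationAt ℝ (fun _ : B => ℝ) b₀).linearMapAt ℝ b a = a := by
  change (Bundle.Trivial.trivialization B ℝ).linearMapAt ℝ b a = a
  rw [Bundle.Trivial.linearMapAt_trivialization]
  rfl

/-- The metric `dt² + t² g` of the cone. -/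
def coneMetric (g : RiemannianMetricOn I M) :
    RiemannianMetricOn (𝓘(ℝ, ℝ).prod I) (ConeManifold M) where
  inner := coneInner g
  symm p u v := by
    rw [coneInner_apply, coneInner_apply, g.symm, mul_comm (coneDt I p u)]
  pos p v hv := by
    rw [coneInner_apply]
    have ht := PosReal.pos p.1
    by_cases h : coneProj I p v = 0
    · have h1 : coneDt I p v ≠ 0 := fun h1 => hv (cone_ext (by simpa using h1) (by simpa using h))
      rw [h]
      simpa using mul_self_pos.2 h1
    · have := g.pos _ _ h
      have := mul_self_nonneg (coneDt I p v)
      positivity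
  isVonNBounded p := by
    have ht := PosReal.pos p.1
    have hb : Bornology.IsVonNBounded ℝ {u : E | g.inner p.2 u u < 1} := g.isVonNBounded p.2
    change Bornology.IsVonNBounded ℝ {v : ℝ × E | coneInner g p v v < 1}
    rw [NormedSpace.isVonNBounded_iff', ] at hb ⊢
    obtain ⟨r, hr⟩ := hb
    refine ⟨max 1 ((p.1 : ℝ)⁻¹ * r), fun v hv => ?_⟩
    have hv' : v.1 * v.1 + (p.1 : ℝ) ^ 2 * g.inner p.2 v.2 v.2 < 1 := hv
    have h0 : 0 ≤ g.inner p.2 v.2 v.2 := by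
      by_cases h : (v.2 : TangentSpace I p.2) = 0
      · exact (clm_apply_self_of_eq_zero (E := E) (g.inner p.2) h).ge
      · exact (g.pos p.2 v.2 h).le
    have h1 : ‖v.1‖ ≤ 1 := by
      rw [Real.norm_eq_abs, ← sq_le_one_iff_abs_le_one]
      nlinarith [mul_nonneg (sq_nonneg (p.1 : ℝ)) h0]
    have h2 := hr ((p.1 : ℝ) • v.2) (by
      have h3 : g.inner p.2 ((p.1 : ℝ) • v.2 : E) ((p.1 : ℝ) • v.2 : E)
          = (p.1 : ℝ) ^ 2 * g.inner p.2 v.2 v.2 :=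
        clm_apply_smul_smul (E := E) (g.inner p.2) _ _
      change g.inner p.2 ((p.1 : ℝ) • v.2 : E) ((p.1 : ℝ) • v.2 : E) < 1
      rw [h3]
      nlinarith [mul_self_nonneg v.1])
    rw [norm_smul, Real.norm_of_nonneg ht.le] at h2
    rw [Prod.norm_def]
    refine max_le_max h1 ?_
    rwa [le_inv_mul_iff₀ ht]
  contMDiff := by
    intro p₀
    rw [contMDiffAt_hom_bundle]
    refine ⟨contMDiffAt_id, ?_⟩
    have ht : ContMDiffAt (𝓘(ℝ, ℝ).prod I) 𝓘(ℝ, ℝ) ∞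
        (fun p : ConeManifold M => (p.1 : ℝ) ^ 2) p₀ := contMDiffAt_coneT.pow 2
    have hg := ((contMDiffAt_hom_bundle _).1 (g.contMDiff p₀.2)).2.comp p₀
      (contMDiffAt_snd (I := 𝓘(ℝ, ℝ)) (J := I) (n := ∞) (p := p₀))
    refine (contMDiffAt_coneForm ht hg).congr_of_eventuallyEq ?_
    filter_upwards [cone_chart_mem_nhds (H := H) p₀] with p hp
    obtain ⟨hs, hs'⟩ := cone_mem_baseSet (I := I) hp
    refine ContinuousLinearMap.ext fun v => ContinuousLinearMap.ext fun w => ?_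
    have h1 := inCoordinates_apply_eq₂ (F₁ := ℝ × E) (F₂ := ℝ × E) (F₃ := ℝ)
      (E₃ := fun _ : ConeManifold M => ℝ) (ϕ := coneInner g p) (v := v) (w := w) hs hs
      (x₀ := p₀) (by trivial)
    refine h1.trans ?_
    have h2 : coneForm ((p.1 : ℝ) ^ 2) (ContinuousLinearMap.inCoordinates E (TangentSpace I)
        (E →L[ℝ] ℝ) (fun x => TangentSpace I x →L[ℝ] ℝ) p₀.2 p.2 p₀.2 p.2 (g.inner p.2)) v w
        = v.1 * w.1 + (p.1 : ℝ) ^ 2 * ContinuousLinearMap.inCoordinates E (TangentSpace I)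
        (E →L[ℝ] ℝ) (fun x => TangentSpace I x →L[ℝ] ℝ) p₀.2 p.2 p₀.2 p.2 (g.inner p.2) v.2 w.2 :=
      rfl
    refine Eq.trans ?_ h2.symm
    have h3 := inCoordinates_apply_eq₂ (F₁ := E) (F₂ := E) (F₃ := ℝ)
      (E₃ := fun _ : M => ℝ) (ϕ := g.inner p.2) (v := v.2) (w := w.2) hs' hs'
      (x₀ := p₀.2) (by trivial)
    rw [h3]
    have h4 := cone_symmL (I := I) p₀ p hp v
    have h5 := cone_symmL (I := I) p₀ p hp w
    rw [linearMapAt_trivial_real, linearMapAt_trivial_real]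
    rw [← Bundle.Trivialization.symmL_apply (R := ℝ) _ hs,
      ← Bundle.Trivialization.symmL_apply (R := ℝ) _ hs,
      ← Bundle.Trivialization.symmL_apply (R := ℝ) _ hs',
      ← Bundle.Trivialization.symmL_apply (R := ℝ) _ hs']
    have h6 : ∀ a b : ℝ × E, coneInner g p a b
        = a.1 * b.1 + (p.1 : ℝ) ^ 2 * g.inner p.2 a.2 b.2 := fun _ _ => rfl
    refine (congrArg₂ (fun a b : ℝ × E => coneInner g p a b) h4 h5).trans ?_
    exact h6 _ _

/-- The almost Hermitian structure induced on the cone by an almost contact metric structure. -/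
def AlmostContactMetricStructure.cone (S : AlmostContactMetricStructure I M) :
    AlmostHermitianStructure (𝓘(ℝ, ℝ).prod I) (ConeManifold M) where
  g := coneMetric S.g
  J := coneJ S
  contMDiff_J := by
    intro p₀
    rw [contMDiffAt_hom_bundle]
    refine ⟨contMDiffAt_id, ?_⟩
    have hsnd := contMDiffAt_snd (I := 𝓘(ℝ, ℝ)) (J := I) (n := ∞) (p := p₀)
    have hφ := ((contMDiffAt_hom_bundle _).1 (S.contMDiff_φ p₀.2)).2.comp p₀ hsnd
    have hη := ((contMDiffAt_hom_bundle _).1 (S.contMDiff_η p₀.2)).2.comp p₀ hsnd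
    have hξ := (contMDiffAt_totalSpace.1 (S.contMDiff_ξ p₀.2)).2.comp p₀ hsnd
    refine (contMDiffAt_coneEndo contMDiffAt_coneT (PosReal.pos p₀.1).ne' hφ hξ
      hη).congr_of_eventuallyEq ?_
    filter_upwards [cone_chart_mem_nhds (H := H) p₀] with p hp
    obtain ⟨hs, hs'⟩ := cone_mem_baseSet (I := I) hp
    refine ContinuousLinearMap.ext fun v => ?_
    have h1 := cone_symmL (I := I) p₀ p hp v
    set ζ := (trivializationAt E (TangentSpace I) p₀.2).symmL ℝ p.2 v.2 with hζ
    have h2 : coneJ S p ((v.1, ζ) : ℝ × E) = (((p.1 : ℝ) * S.η p.2 ζ,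
        S.φ p.2 ζ - (p.1 : ℝ)⁻¹ • v.1 • S.ξ p.2) : ℝ × E) := rfl
    refine (congrArg (fun a : ℝ × E => (trivializationAt (ℝ × E)
      (TangentSpace (𝓘(ℝ, ℝ).prod I)) p₀).continuousLinearMapAt ℝ p (coneJ S p a)) h1).trans ?_
    refine (congrArg ((trivializationAt (ℝ × E)
      (TangentSpace (𝓘(ℝ, ℝ).prod I)) p₀).continuousLinearMapAt ℝ p) h2).trans ?_
    refine (cone_continuousLinearMapAt (I := I) p₀ p hp _).trans ?_
    refine Prod.ext ?_ ?_
    · change (p.1 : ℝ) * S.η p.2 ζ = (p.1 : ℝ) *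
        (trivializationAt ℝ (fun _ : M => ℝ) p₀.2).linearMapAt ℝ p.2 (S.η p.2 ζ)
      rw [linearMapAt_trivial_real]
    · change (trivializationAt E (TangentSpace I) p₀.2).continuousLinearMapAt ℝ p.2
        (S.φ p.2 ζ - (p.1 : ℝ)⁻¹ • v.1 • S.ξ p.2) = _
      rw [map_sub, map_smul, map_smul,
        Bundle.Trivialization.continuousLinearMapAt_apply_of_mem (R := ℝ)
          (trivializationAt E (TangentSpace I) p₀.2) hs' (S.ξ p.2)]
      rfl
  J_J p u := by
    have ht := (PosReal.pos p.1).ne'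
    apply cone_ext
    · rw [coneDt_coneJ, coneProj_coneJ, map_sub, S.η_φ, map_smul, map_smul, S.η_ξ, map_neg]
      simp [ht]
    · rw [coneProj_coneJ, coneProj_coneJ, coneDt_coneJ, map_sub, S.φ_φ, map_smul, map_smul,
        S.φ_ξ, map_neg, smul_smul, smul_smul, inv_mul_cancel_left₀ ht]
      simp
  g_J_J p u v := by
    have ht := (PosReal.pos p.1).ne'
    change coneInner S.g p _ _ = coneInner S.g p _ _
    have h1 := S.g_ξ p.2 (S.φ p.2 (coneProj I p u))
    have h2 := S.g_ξ p.2 (S.φ p.2 (coneProj I p v))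
    have h3 := S.g_ξ p.2 (S.ξ p.2)
    rw [S.η_φ] at h1 h2
    rw [S.η_ξ] at h3
    rw [coneInner_apply, coneInner_apply, coneDt_coneJ, coneDt_coneJ, coneProj_coneJ,
      coneProj_coneJ]
    simp only [map_sub, map_smul, sub_apply, smul_apply,
      h1, h2, h3, S.g_φ_φ, S.g.symm p.2 (S.ξ p.2) (S.φ _ _), smul_eq_mul]
    field_simp
    ring

end Cone

end

open Filter Topology

section LocalCurvature

variable {E : Type*} [NormedAddCommGroup E] [NormedSpace ℝ E]

noncomputable local instance : NormedAddCommGroup (E →L[ℝ] E →L[ℝ] ℝ) :=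
  ContinuousLinearMap.toNormedAddCommGroup

noncomputable local instance : NormedSpace ℝ (E →L[ℝ] E →L[ℝ] ℝ) :=
  ContinuousLinearMap.toNormedSpace

noncomputable local instance : NormedAddCommGroup (E →L[ℝ] E →L[ℝ] E →L[ℝ] ℝ) :=
  ContinuousLinearMap.toNormedAddCommGroup

noncomputable local instance : NormedSpace ℝ (E →L[ℝ] E →L[ℝ] E →L[ℝ] ℝ) :=
  ContinuousLinearMap.toNormedSpace

noncomputable local instance : AddCommGroup (E →L[ℝ] E →L[ℝ] ℝ) :=
  NormedAddCommGroup.toAddCommGroup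

noncomputable local instance : AddCommGroup (E →L[ℝ] E →L[ℝ] E →L[ℝ] ℝ) :=
  NormedAddCommGroup.toAddCommGroup

/-- The Christoffel symbols of the first kind of a metric `G`. -/
noncomputable def christoffelFirst (G : E → E →L[ℝ] E →L[ℝ] ℝ) (y u v w : E) : ℝ :=
  (1 / 2 : ℝ) * (fderiv ℝ G y u v w + fderiv ℝ G y v u w - fderiv ℝ G y w u v)

/-- The combination of second derivatives of the metric in the Riemann-Christoffel tensor. -/
noncomputable def secondOrderCurvature (G : E → E →L[ℝ] E →L[ℝ] ℝ) (y u v w z : E) : ℝ :=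
  (1 / 2 : ℝ) * (fderiv ℝ (fderiv ℝ G) y u w v z - fderiv ℝ (fderiv ℝ G) y u z v w
    - fderiv ℝ (fderiv ℝ G) y v w u z + fderiv ℝ (fderiv ℝ G) y v z u w)

variable {G : E → E →L[ℝ] E →L[ℝ] ℝ} {y : E}

lemma apply_christoffel (hi : (G y).IsInvertible) (u v w : E) :
    G y (christoffel G y u v) w = christoffelFirst G y u v w := by
  simp [christoffel, hi.self_apply_inverse, christoffelFirst]

lemma eq_christoffel (hi : (G y).IsInvertible) {u v a : E}
    (h : ∀ w, G y a w = christoffelFirst G y u v w) : a = christoffel G y u v :=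
  hi.injective (ContinuousLinearMap.ext fun w => (h w).trans (apply_christoffel hi u v w).symm)

lemma ContDiffAt.eventually_isInvertible [CompleteSpace E] (hG : ContDiffAt ℝ 2 G y)
    (hi : (G y).IsInvertible) : ∀ᶠ z in 𝓝 y, (G z).IsInvertible := by
  obtain ⟨e, he⟩ := hi
  exact hG.continuousAt.eventually (he ▸ ContinuousLinearEquiv.nhds e)

lemma fderiv_apply_comm (hG : DifferentiableAt ℝ G y) (hs : ∀ z u v, G z u v = G z v u)
    (u v w : E) : fderiv ℝ G y u v w = fderiv ℝ G y u w v := by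
  have h (v w : E) : HasFDerivAt (fun z => G z v w) ((fderiv ℝ G y).flip v |>.flip w) y :=
    (hG.hasFDerivAt.clm_apply (hasFDerivAt_const v y)).clm_apply (hasFDerivAt_const w y)
      |>.congr_fderiv (by ext; simp)
  have h' : (fun z => G z v w) = fun z => G z w v := funext fun z => hs z v w
  exact congrArg (fun L : E →L[ℝ] ℝ => L u) ((h v w).unique (h' ▸ h w v))

lemma hasFDerivAt_fderiv_apply (hG : ContDiffAt ℝ 2 G y) (u v w : E) :
    HasFDerivAt (fun z => fderiv ℝ G z u v w)
      ((((fderiv ℝ (fderiv ℝ G) y).flip u).flip v).flip w) y := by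
  have hd : DifferentiableAt ℝ (fderiv ℝ G) y :=
    (hG.fderiv_right (m := 1) (by norm_num)).differentiableAt (by norm_num)
  exact ((hd.hasFDerivAt.clm_apply (hasFDerivAt_const u y)).clm_apply
    (hasFDerivAt_const v y)).clm_apply (hasFDerivAt_const w y) |>.congr_fderiv (by ext; simp)

lemma differentiableAt_christoffel [CompleteSpace E] (hG : ContDiffAt ℝ 2 G y)
    (hi : (G y).IsInvertible) (u v : E) :
    DifferentiableAt ℝ (fun z => christoffel G z u v) y := by
  have hd : DifferentiableAt ℝ (fderiv ℝ G) y :=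
    (hG.fderiv_right (m := 1) (by norm_num)).differentiableAt (by norm_num)
  have hinv : DifferentiableAt ℝ (fun z => (G z).inverse) y :=
    ((hi.contDiffAt_map_inverse (n := 2)).comp y hG).differentiableAt (by norm_num)
  have hflip (z u v : E) : ((fderiv ℝ G z).flip u).flip v
      = (((ContinuousLinearMap.apply ℝ ℝ v).comp
        (ContinuousLinearMap.apply ℝ (E →L[ℝ] ℝ) u)).comp (fderiv ℝ G z)) := by
    ext; simp
  simp only [christoffel, hflip]
  fun_prop

lemma localCurvature_const (u v w : E) :
    localCurvature G (fun _ => u) (fun _ => v) (fun _ => w) y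
      = (fderiv ℝ (fun z => christoffel G z v w) y u + christoffel G y u (christoffel G y v w))
        - (fderiv ℝ (fun z => christoffel G z u w) y v
          + christoffel G y v (christoffel G y u w)) := by
  have h0 (a b : E) : localLeviCivita G (fun _ => a) (fun _ => b)
      = fun z => christoffel G z a b := by
    funext z
    simp [localLeviCivita]
  have hb : VectorField.lieBracket ℝ (fun _ : E => u) (fun _ => v) = fun _ => 0 := by
    funext z
    simp [VectorField.lieBracket]
  have hc : christoffel G y 0 w = 0 := by
    simp [christoffel]
  simp only [localCurvature, h0, hb, Pi.sub_apply, hc, sub_zero]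
  rfl

/-- The covariant derivative of a Christoffel symbol, paired with a vector. -/
lemma apply_fderiv_christoffel [CompleteSpace E] (hG : ContDiffAt ℝ 2 G y)
    (hs : ∀ z u v, G z u v = G z v u) (hi : (G y).IsInvertible) (u v w z : E) :
    G y (fderiv ℝ (fun z => christoffel G z v w) y u + christoffel G y u (christoffel G y v w)) z
      = (1 / 2 : ℝ) * (fderiv ℝ (fderiv ℝ G) y u v w z + fderiv ℝ (fderiv ℝ G) y u w v z
        - fderiv ℝ (fderiv ℝ G) y u z v w)
        - G y (christoffel G y u z) (christoffel G y v w) := by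
  have hd : DifferentiableAt ℝ G y := hG.differentiableAt (by norm_num)
  have h1 := ((hd.hasFDerivAt.clm_apply
    (differentiableAt_christoffel hG hi v w).hasFDerivAt).clm_apply (hasFDerivAt_const z y))
  have h2 := (((hasFDerivAt_fderiv_apply hG v w z).add (hasFDerivAt_fderiv_apply hG w v z)).sub
    (hasFDerivAt_fderiv_apply hG z v w)).const_mul (1 / 2 : ℝ)
  have h3 : (fun x => G x (christoffel G x v w) z) =ᶠ[𝓝 y]
      fun x => (1 / 2 : ℝ) * (fderiv ℝ G x v w z + fderiv ℝ G x w v z - fderiv ℝ G x z v w) := by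
    filter_upwards [hG.eventually_isInvertible hi] with x hx
    exact apply_christoffel hx v w z
  have h4 := congrArg (fun L : E →L[ℝ] ℝ => L u) (h1.unique (h2.congr_of_eventuallyEq h3))
  simp at h4
  rw [map_add, add_apply, apply_christoffel hi u _ z,
    apply_christoffel hi u z]
  have h5 := fderiv_apply_comm hd hs u z (christoffel G y v w)
  simp only [christoffelFirst]
  linear_combination h4 + (1 / 2 : ℝ) * h5

/-- The Riemann-Christoffel tensor in terms of the derivatives of the metric. -/
lemma apply_localCurvature_const [CompleteSpace E] (hG : ContDiffAt ℝ 2 G y)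
    (hs : ∀ z u v, G z u v = G z v u) (hi : (G y).IsInvertible) (u v w z : E) :
    G y (localCurvature G (fun _ => u) (fun _ => v) (fun _ => w) y) z
      = secondOrderCurvature G y u v w z
        - G y (christoffel G y u z) (christoffel G y v w)
        + G y (christoffel G y v z) (christoffel G y u w) := by
  have hsymm := (hG.isSymmSndFDerivAt (by simp)).eq u v
  rw [localCurvature_const, map_sub, sub_apply,
    apply_fderiv_christoffel hG hs hi, apply_fderiv_christoffel hG hs hi, secondOrderCurvature,
    hsymm]
  ring

lemma fderiv_fderiv_apply_comm (hG : ContDiffAt ℝ 2 G y) (hs : ∀ z u v, G z u v = G z v u)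
    (u v w z : E) :
    fderiv ℝ (fderiv ℝ G) y u v w z = fderiv ℝ (fderiv ℝ G) y u v z w := by
  have h : (fun x => fderiv ℝ G x v w z) =ᶠ[𝓝 y] fun x => fderiv ℝ G x v z w := by
    filter_upwards [(hG.eventually (by simp))] with x hx
    exact fderiv_apply_comm (hx.differentiableAt (by norm_num)) hs v w z
  exact congrArg (fun L : E →L[ℝ] ℝ => L u) ((hasFDerivAt_fderiv_apply hG v w z).unique
    ((hasFDerivAt_fderiv_apply hG v z w).congr_of_eventuallyEq h))

lemma christoffel_comm (hd : DifferentiableAt ℝ G y) (hs : ∀ z u v, G z u v = G z v u) (u v : E) :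
    christoffel G y u v = christoffel G y v u := by
  have h : ((fderiv ℝ G y).flip u).flip v = ((fderiv ℝ G y).flip v).flip u :=
    ContinuousLinearMap.ext fun w => fderiv_apply_comm hd hs w u v
  rw [christoffel, christoffel, h, add_comm (fderiv ℝ G y u v)]

lemma apply_localCurvature_reverse [CompleteSpace E] (hG : ContDiffAt ℝ 2 G y)
    (hs : ∀ z u v, G z u v = G z v u) (hi : (G y).IsInvertible) (u v w z : E) :
    G y (localCurvature G (fun _ => z) (fun _ => w) (fun _ => v) y) u
      = G y (localCurvature G (fun _ => u) (fun _ => v) (fun _ => w) y) z := by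
  have hd : DifferentiableAt ℝ G y := hG.differentiableAt (by norm_num)
  have hc := christoffel_comm hd hs
  have h2 (a b : E) := (hG.isSymmSndFDerivAt (by simp)).eq a b
  have h3 := fderiv_fderiv_apply_comm hG hs
  rw [apply_localCurvature_const hG hs hi, apply_localCurvature_const hG hs hi,
    secondOrderCurvature, secondOrderCurvature, hc z u, hc w v, hc w u, hc z v,
    hs y (christoffel G y u w), h2 z v, h2 z u, h2 w v, h2 w u, h3 v z w u, h3 u z w v, h3 v w z u,
    h3 u w z v]
  ring

lemma apply_localCurvature_swap [CompleteSpace E] (u v w z : E) :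
    G y (localCurvature G (fun _ => u) (fun _ => v) (fun _ => w) y) z
      = - G y (localCurvature G (fun _ => v) (fun _ => u) (fun _ => w) y) z := by
  rw [localCurvature_const, localCurvature_const, ← neg_sub, map_neg,
    neg_apply]

section ConeCurvature

variable {F : ℝ × E → ℝ × E →L[ℝ] ℝ × E →L[ℝ] ℝ} {G : E → E →L[ℝ] E →L[ℝ] ℝ} {t : ℝ} {y : E}

lemma coneForm_apply (c : ℝ) (b : E →L[ℝ] E →L[ℝ] ℝ) (V W : ℝ × E) :
    coneForm c b V W = V.1 * W.1 + c * b V.2 W.2 :=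
  rfl

lemma fderiv_cone_apply (hF : ContDiffAt ℝ 2 F (t, y)) (hG : ContDiffAt ℝ 2 G y)
    (h : F =ᶠ[𝓝 (t, y)] fun q => coneForm (q.1 ^ 2) (G q.2)) (V W Z : ℝ × E) :
    fderiv ℝ F (t, y) V W Z
      = 2 * t * V.1 * G y W.2 Z.2 + t ^ 2 * fderiv ℝ G y V.2 W.2 Z.2 := by
  have hF' := ((hF.differentiableAt (by norm_num)).hasFDerivAt.clm_apply
    (hasFDerivAt_const W _)).clm_apply (hasFDerivAt_const Z _)
  have hG' : HasFDerivAt (fun q : ℝ × E => G q.2) _ (t, y) :=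
    (hG.differentiableAt (by norm_num)).hasFDerivAt.comp (t, y) hasFDerivAt_snd
  have h1 := (((hasFDerivAt_fst (𝕜 := ℝ) (p := (t, y))).pow 2).mul
    ((hG'.clm_apply (hasFDerivAt_const W.2 _)).clm_apply
      (hasFDerivAt_const Z.2 _))).const_add (W.1 * Z.1)
  have h2 : (fun q => F q W Z) =ᶠ[𝓝 (t, y)]
      fun q => W.1 * Z.1 + q.1 ^ 2 * G q.2 W.2 Z.2 := by
    filter_upwards [h] with q hq
    rw [hq, coneForm_apply]
  have h3 := congrArg (fun L : ℝ × E →L[ℝ] ℝ => L V) (hF'.unique (h1.congr_of_eventuallyEq h2))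
  simp at h3
  rw [h3]
  ring

lemma fderiv_fderiv_cone_apply (hF : ContDiffAt ℝ 2 F (t, y)) (hG : ContDiffAt ℝ 2 G y)
    (h : F =ᶠ[𝓝 (t, y)] fun q => coneForm (q.1 ^ 2) (G q.2)) (U V W Z : ℝ × E) :
    fderiv ℝ (fderiv ℝ F) (t, y) U V W Z
      = 2 * U.1 * V.1 * G y W.2 Z.2 + 2 * t * V.1 * fderiv ℝ G y U.2 W.2 Z.2
        + 2 * t * U.1 * fderiv ℝ G y V.2 W.2 Z.2
        + t ^ 2 * fderiv ℝ (fderiv ℝ G) y U.2 V.2 W.2 Z.2 := by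
  have h0 : (fun q => fderiv ℝ F q V W Z) =ᶠ[𝓝 (t, y)] fun q =>
      2 * V.1 * (q.1 * G q.2 W.2 Z.2) + q.1 ^ 2 * fderiv ℝ G q.2 V.2 W.2 Z.2 := by
    filter_upwards [hF.eventually (by simp), h.eventuallyEq_nhds,
      continuousAt_snd.eventually (hG.eventually (by simp))] with q h1 h2 h3
    rw [fderiv_cone_apply (t := q.1) (y := q.2) h1 h3 h2]
    ring
  have hG' : HasFDerivAt (fun q : ℝ × E => G q.2) _ (t, y) :=
    (hG.differentiableAt (by norm_num)).hasFDerivAt.comp (t, y) hasFDerivAt_snd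
  have hG2 : HasFDerivAt (fun q : ℝ × E => fderiv ℝ G q.2 V.2 W.2 Z.2) _ (t, y) :=
    HasFDerivAt.comp (g := fun z => fderiv ℝ G z V.2 W.2 Z.2) (t, y)
      (hasFDerivAt_fderiv_apply hG V.2 W.2 Z.2) hasFDerivAt_snd
  have h1 := (((hasFDerivAt_fst (𝕜 := ℝ) (p := (t, y))).mul
    ((hG'.clm_apply (hasFDerivAt_const W.2 _)).clm_apply
      (hasFDerivAt_const Z.2 _))).const_mul (2 * V.1)).add
    (((hasFDerivAt_fst (𝕜 := ℝ) (p := (t, y))).pow 2).mul hG2)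
  have h3 := congrArg (fun L : ℝ × E →L[ℝ] ℝ => L U)
    ((hasFDerivAt_fderiv_apply hF V W Z).unique (h1.congr_of_eventuallyEq h0))
  simp at h3
  rw [h3]
  ring

lemma christoffel_cone (hF : ContDiffAt ℝ 2 F (t, y)) (hG : ContDiffAt ℝ 2 G y)
    (h : F =ᶠ[𝓝 (t, y)] fun q => coneForm (q.1 ^ 2) (G q.2)) (ht : t ≠ 0)
    (hs : ∀ z u v, G z u v = G z v u)
    (hFi : (F (t, y)).IsInvertible) (hGi : (G y).IsInvertible) (U V : ℝ × E) :
    christoffel F (t, y) U V = (-t * G y U.2 V.2,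
      christoffel G y U.2 V.2 + (U.1 / t) • V.2 + (V.1 / t) • U.2) := by
  refine (eq_christoffel hFi fun W => ?_).symm
  rw [h.eq_of_nhds, coneForm_apply]
  simp only [map_add, map_smul, add_apply, smul_apply, smul_eq_mul, apply_christoffel hGi,
    christoffelFirst, fderiv_cone_apply hF hG h, hs y U.2 W.2, hs y V.2 W.2]
  field_simp
  rw [hs y W.2 U.2, hs y W.2 V.2]
  ring

/-- The curvature of a cone in terms of the curvature of its base. -/
lemma apply_localCurvature_cone [CompleteSpace E] (hF : ContDiffAt ℝ 2 F (t, y))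
    (hG : ContDiffAt ℝ 2 G y)
    (h : F =ᶠ[𝓝 (t, y)] fun q => coneForm (q.1 ^ 2) (G q.2)) (ht : t ≠ 0)
    (hFs : ∀ z u v, F z u v = F z v u) (hs : ∀ z u v, G z u v = G z v u)
    (hFi : (F (t, y)).IsInvertible) (hGi : (G y).IsInvertible) (U V W Z : ℝ × E) :
    F (t, y) (localCurvature F (fun _ => U) (fun _ => V) (fun _ => W) (t, y)) Z
      = t ^ 2 * (G y (localCurvature G (fun _ => U.2) (fun _ => V.2) (fun _ => W.2) y) Z.2
        - G y U.2 Z.2 * G y V.2 W.2 + G y V.2 Z.2 * G y U.2 W.2) := by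
  have hd := fderiv_apply_comm (hG.differentiableAt (by norm_num)) hs
  rw [apply_localCurvature_const hF hFs hFi, apply_localCurvature_const hG hs hGi]
  have hr (a b c : E) : G y a (christoffel G y b c) = christoffelFirst G y b c a := by
    rw [hs, apply_christoffel hGi]
  have hp (a b c d : E) : G y (christoffel G y a b) (christoffel G y c d)
      = christoffelFirst G y a b (christoffel G y c d) := apply_christoffel hGi _ _ _
  simp only [secondOrderCurvature, fderiv_fderiv_cone_apply hF hG h,
    christoffel_cone hF hG h ht hs hFi hGi, h.eq_of_nhds, coneForm_apply, map_add, map_smul,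
    add_apply, smul_apply, smul_eq_mul, hp, hr, apply_christoffel hGi]
  generalize christoffelFirst G y U.2 Z.2 (christoffel G y V.2 W.2) = A
  generalize christoffelFirst G y V.2 Z.2 (christoffel G y U.2 W.2) = B
  simp only [christoffelFirst]
  rw [hd U.2 V.2 Z.2, hd U.2 W.2 Z.2, hd U.2 V.2 W.2, hd V.2 U.2 Z.2, hd V.2 W.2 Z.2,
    hd V.2 U.2 W.2, hd W.2 U.2 Z.2, hd W.2 U.2 V.2, hd W.2 V.2 Z.2,
    hd Z.2 U.2 V.2, hd Z.2 U.2 W.2, hd Z.2 V.2 W.2,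
    hs y U.2 V.2, hs y U.2 W.2, hs y U.2 Z.2, hs y V.2 W.2, hs y V.2 Z.2]
  field_simp
  ring

end ConeCurvature

end LocalCurvature

section MetricInChart

variable {E : Type*} [NormedAddCommGroup E] [NormedSpace ℝ E]
  {H : Type*} [TopologicalSpace H] {I : ModelWithCorners ℝ E H}
  {M : Type*} [TopologicalSpace M] [ChartedSpace H M] [IsManifold I ∞ M]

/-- A positive definite bilinear form on a finite-dimensional space is nondegenerate. -/
lemma isInvertible_of_pos [FiniteDimensional ℝ E] (b : E →L[ℝ] E →L[ℝ] ℝ)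
    (hb : ∀ v, v ≠ 0 → 0 < b v v) : b.IsInvertible := by
  have hinj : Function.Injective (b : E →ₗ[ℝ] E →L[ℝ] ℝ) := by
    rw [← LinearMap.ker_eq_bot, LinearMap.ker_eq_bot']
    intro v hv
    by_contra h
    have h1 := hb v h
    have h2 : b v = 0 := hv
    rw [h2] at h1
    exact lt_irrefl _ h1
  have hdim : Module.finrank ℝ E = Module.finrank ℝ (E →L[ℝ] ℝ) := by
    rw [(LinearMap.toContinuousLinearMap (𝕜 := ℝ) (E := E) (F' := ℝ)).symm.finrank_eq]
    exact (Subspace.dual_finrank_eq (K := ℝ) (V := E)).symm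
  refine ⟨(LinearEquiv.ofInjectiveOfFinrankEq _ hinj hdim).toContinuousLinearEquiv, ?_⟩
  ext v
  rfl

lemma metricInChart_apply (g : RiemannianMetricOn I M) (x : M) (y u v : E) :
    metricInChart g x y u v = g.inner ((extChartAt I x).symm y)
      (mfderiv 𝓘(ℝ, E) I (extChartAt I x).symm y u)
      (mfderiv 𝓘(ℝ, E) I (extChartAt I x).symm y v) :=
  rfl

lemma metricInChart_comm (g : RiemannianMetricOn I M) (x : M) (y u v : E) :
    metricInChart g x y u v = metricInChart g x y v u := by
  rw [metricInChart_apply, metricInChart_apply]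
  exact g.symm _ _ _

variable [I.Boundaryless]

lemma metricInChart_self (g : RiemannianMetricOn I M) (x : M) :
    metricInChart g x (extChartAt I x x) = (g.inner x : E →L[ℝ] E →L[ℝ] ℝ) := by
  have h := mfderivWithin_range_extChartAt_symm (I := I) (x := x)
  rw [I.range_eq_univ, mfderivWithin_univ] at h
  unfold metricInChart
  rw [h]
  have h1 : (extChartAt I x).symm (extChartAt I x x) = x := extChartAt_to_inv x
  have h2 (p : M) (hp : p = x) : ContinuousLinearMap.bilinearComp (E := E) (F := E)
      (g.inner p : E →L[ℝ] E →L[ℝ] ℝ) (ContinuousLinearMap.id ℝ E)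
      (ContinuousLinearMap.id ℝ E) = (g.inner x : E →L[ℝ] E →L[ℝ] ℝ) := by
    subst hp
    rfl
  exact h2 _ h1

lemma isInvertible_metricInChart_self [FiniteDimensional ℝ E] (g : RiemannianMetricOn I M)
    (x : M) : (metricInChart g x (extChartAt I x x)).IsInvertible := by
  rw [metricInChart_self]
  exact isInvertible_of_pos (E := E) (g.inner x) (g.pos x)

lemma contDiffAt_metricInChart (g : RiemannianMetricOn I M) (x : M) :
    ContDiffAt ℝ ∞ (metricInChart g x) (extChartAt I x x) := by
  have h1 := ((contMDiffAt_hom_bundle _).1 (g.contMDiff x)).2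
  have h2 : ContMDiffAt 𝓘(ℝ, E) I ∞ (extChartAt I x).symm (extChartAt I x x) :=
    (contMDiffOn_extChartAt_symm x).contMDiffAt (extChartAt_target_mem_nhds x)
  rw [← extChartAt_to_inv (I := I) x] at h1
  have h3 := h1.comp (extChartAt I x x) h2
  rw [← contMDiffAt_iff_contDiffAt]
  refine h3.congr_of_eventuallyEq ?_
  filter_upwards [extChartAt_target_mem_nhds (I := I) x] with y hy
  have hp : (extChartAt I x).symm y ∈ (chartAt H x).source := by
    have := (extChartAt I x).map_target hy
    rwa [extChartAt_source] at this
  have hs : (extChartAt I x).symm y ∈ (trivializationAt E (TangentSpace I) x).baseSet := by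
    rwa [TangentBundle.trivializationAt_baseSet]
  have h4 := TangentBundle.symmL_trivializationAt (𝕜 := ℝ) (I := I) hp
  rw [I.range_eq_univ, mfderivWithin_univ, (extChartAt I x).right_inv hy] at h4
  refine ContinuousLinearMap.ext fun u => ContinuousLinearMap.ext fun v => ?_
  rw [metricInChart_apply, ← h4]
  have h5 := inCoordinates_apply_eq₂ (F₁ := E) (F₂ := E) (F₃ := ℝ)
    (E₃ := fun _ : M => ℝ) (ϕ := g.inner ((extChartAt I x).symm y)) (v := u) (w := v) hs hs
    (x₀ := x) (by trivial)
  rw [linearMapAt_trivial_real, ← Bundle.Trivialization.symmL_apply (R := ℝ) _ hs,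
    ← Bundle.Trivialization.symmL_apply (R := ℝ) _ hs] at h5
  rw [Function.comp_apply, extChartAt_to_inv]
  exact h5.symm

end MetricInChart

section ConeMetric

lemma mdifferentiableAt_extChartAt_symm_posReal (t₀ t : PosReal) :
    MDifferentiableAt 𝓘(ℝ, ℝ) 𝓘(ℝ, ℝ) (extChartAt 𝓘(ℝ, ℝ) t₀).symm (t : ℝ) := by
  have h := mdifferentiableWithinAt_extChartAt_symm (I := 𝓘(ℝ, ℝ))
    (mem_extChartAt_target (I := 𝓘(ℝ, ℝ)) t)
  rw [ModelWithCorners.range_eq_univ, mdifferentiableWithinAt_univ] at h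
  exact h

lemma mfderiv_extChartAt_symm_posReal (t₀ t : PosReal) :
    mfderiv 𝓘(ℝ, ℝ) 𝓘(ℝ, ℝ) (extChartAt 𝓘(ℝ, ℝ) t₀).symm (t : ℝ)
      = ContinuousLinearMap.id ℝ ℝ := by
  have h := mfderivWithin_range_extChartAt_symm (I := 𝓘(ℝ, ℝ)) (x := t)
  rw [ModelWithCorners.range_eq_univ, mfderivWithin_univ] at h
  exact h

variable {E : Type*} [NormedAddCommGroup E] [NormedSpace ℝ E]
  {H : Type*} [TopologicalSpace H] {I : ModelWithCorners ℝ E H}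
  {M : Type*} [TopologicalSpace M] [ChartedSpace H M] [IsManifold I ∞ M]

lemma extChartAt_cone_self (p : ConeManifold M) :
    extChartAt (𝓘(ℝ, ℝ).prod I) p p = ((p.1 : ℝ), extChartAt I p.2 p.2) := by
  rw [extChartAt_prod]
  rfl

variable [I.Boundaryless]

lemma mfderiv_extChartAt_symm_cone (p : ConeManifold M) (t : PosReal) {y : E}
    (hy : y ∈ (extChartAt I p.2).target) (v : ℝ × E) :
    mfderiv 𝓘(ℝ, ℝ × E) (𝓘(ℝ, ℝ).prod I) (extChartAt (𝓘(ℝ, ℝ).prod I) p).symm ((t : ℝ), y) v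
      = ((v.1, mfderiv 𝓘(ℝ, E) I (extChartAt I p.2).symm y v.2) : ℝ × E) := by
  have h1 : ((extChartAt (𝓘(ℝ, ℝ).prod I) p).symm : ℝ × E → ConeManifold M)
      = Prod.map (extChartAt 𝓘(ℝ, ℝ) p.1).symm (extChartAt I p.2).symm := by
    rw [extChartAt_prod]
    rfl
  have h2 := mdifferentiableWithinAt_extChartAt_symm hy
  rw [I.range_eq_univ, mdifferentiableWithinAt_univ] at h2
  rw [h1, modelWithCornersSelf_prod, ← chartedSpaceSelf_prod]
  have h3 := mfderiv_prodMap (p := ((t : ℝ), y))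
    (mdifferentiableAt_extChartAt_symm_posReal p.1 t) h2
  rw [mfderiv_extChartAt_symm_posReal] at h3
  exact congrFun (congrArg DFunLike.coe h3) v

lemma metricInChart_coneMetric (g : RiemannianMetricOn I M) (p : ConeManifold M) :
    metricInChart (coneMetric g) p =ᶠ[𝓝 ((p.1 : ℝ), extChartAt I p.2 p.2)]
      fun q => coneForm (q.1 ^ 2) (metricInChart g p.2 q.2) := by
  have h1 : ∀ᶠ q : ℝ × E in 𝓝 ((p.1 : ℝ), extChartAt I p.2 p.2), 0 < q.1 :=
    continuousAt_fst.eventually (lt_mem_nhds (PosReal.pos p.1))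
  have h2 : ∀ᶠ q : ℝ × E in 𝓝 ((p.1 : ℝ), extChartAt I p.2 p.2),
      q.2 ∈ (extChartAt I p.2).target :=
    continuousAt_snd.eventually (extChartAt_target_mem_nhds (I := I) p.2)
  filter_upwards [h1, h2] with q hq1 hq2
  obtain ⟨s, y⟩ := q
  refine ContinuousLinearMap.ext fun v => ContinuousLinearMap.ext fun w => ?_
  have h3 := mfderiv_extChartAt_symm_cone p ⟨s, hq1⟩ hq2
  have h4 : (extChartAt (𝓘(ℝ, ℝ).prod I) p).symm (s, y)
      = ((extChartAt 𝓘(ℝ, ℝ) p.1).symm s, (extChartAt I p.2).symm y) := by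
    rw [extChartAt_prod]
    rfl
  have h5 : ∀ (r : ConeManifold M)
      (_ : r = ((extChartAt 𝓘(ℝ, ℝ) p.1).symm s, (extChartAt I p.2).symm y))
      (a b : ℝ × E), coneInner g r a b
        = a.1 * b.1 + s ^ 2 * g.inner ((extChartAt I p.2).symm y) a.2 b.2 := by
    rintro r rfl a b
    change a.1 * b.1 + (((extChartAt 𝓘(ℝ, ℝ) p.1).symm s : PosReal) : ℝ) ^ 2 * _ = _
    rw [posReal_extChartAt_symm p.1 (show 0 < s from hq1)]
    rfl
  refine (congrArg₂ (fun a b : ℝ × E => coneInner g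
    ((extChartAt (𝓘(ℝ, ℝ).prod I) p).symm (s, y)) a b) (h3 v) (h3 w)).trans ?_
  exact h5 _ h4 _ _

variable [FiniteDimensional ℝ E]

/-- The Riemann-Christoffel tensor of a metric cone. -/
lemma riemannChristoffel_coneMetric (g : RiemannianMetricOn I M) (p : ConeManifold M)
    (A B C D : TangentSpace (𝓘(ℝ, ℝ).prod I) p) :
    riemannChristoffel (coneMetric g) p A B C D
      = (p.1 : ℝ) ^ 2 * (riemannChristoffel g p.2 (coneProj I p A) (coneProj I p B)
          (coneProj I p C) (coneProj I p D)
        + g.inner p.2 (coneProj I p B) (coneProj I p C)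
          * g.inner p.2 (coneProj I p A) (coneProj I p D)
        - g.inner p.2 (coneProj I p A) (coneProj I p C)
          * g.inner p.2 (coneProj I p B) (coneProj I p D)) := by
  have : CompleteSpace E := FiniteDimensional.complete ℝ E
  have hF := contDiffAt_metricInChart (coneMetric g) p
  have hFi := isInvertible_metricInChart_self (coneMetric g) p
  have hF0 := metricInChart_self (coneMetric g) p
  have hG0 := metricInChart_self g p.2
  rw [extChartAt_cone_self] at hF hFi hF0
  have key := apply_localCurvature_cone (hF.of_le (WithTop.coe_le_coe.2 le_top))
    ((contDiffAt_metricInChart g p.2).of_le (WithTop.coe_le_coe.2 le_top))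
    (metricInChart_coneMetric g p) (PosReal.pos p.1).ne'
    (metricInChart_comm (coneMetric g) p) (metricInChart_comm g p.2) hFi
    (isInvertible_metricInChart_self g p.2) A B C D
  rw [hF0, hG0] at key
  have h1 : riemannChristoffel (coneMetric g) p A B C D
      = -(coneMetric g).inner p (localCurvature (E := ℝ × E) (metricInChart (coneMetric g) p)
        (fun _ => A) (fun _ => B) (fun _ => C) ((p.1 : ℝ), extChartAt I p.2 p.2)) D := by
    rw [← extChartAt_cone_self]
    rfl
  rw [h1]
  refine (congrArg Neg.neg key).trans ?_
  change -(_ * (g.inner p.2 (curvature g p.2 (coneProj I p A) (coneProj I p B) (coneProj I p C))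
      (coneProj I p D)
    - g.inner p.2 (coneProj I p A) (coneProj I p D) * g.inner p.2 (coneProj I p B) (coneProj I p C)
    + g.inner p.2 (coneProj I p B) (coneProj I p D)
      * g.inner p.2 (coneProj I p A) (coneProj I p C))) = _
  rw [riemannChristoffel]
  ring

lemma riemannChristoffel_reverse (g : RiemannianMetricOn I M) (x : M)
    (u v w z : TangentSpace I x) :
    riemannChristoffel g x z w v u = riemannChristoffel g x u v w z := by
  have : CompleteSpace E := FiniteDimensional.complete ℝ E
  have h := apply_localCurvature_reverse
    ((contDiffAt_metricInChart g x).of_le (WithTop.coe_le_coe.2 le_top))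
    (metricInChart_comm g x) (isInvertible_metricInChart_self g x) u v w z
  rw [metricInChart_self] at h
  exact congrArg Neg.neg h

lemma riemannChristoffel_swap (g : RiemannianMetricOn I M) (x : M)
    (u v w z : TangentSpace I x) :
    riemannChristoffel g x u v w z = -riemannChristoffel g x v u w z := by
  have : CompleteSpace E := FiniteDimensional.complete ℝ E
  have h := apply_localCurvature_swap (G := metricInChart g x) (y := extChartAt I x x) u v w z
  rw [metricInChart_self] at h
  exact congrArg Neg.neg h

end ConeMetric

section CurvatureIdentities

/-- For a tensor with the symmetries of a curvature tensor, the identity `(K2)` of the cone, whose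
almost complex structure projects to `X ↦ φ X - a ξ`, amounts to an identity involving `φ` only. -/
lemma curvatureLike_K2_iff {V : Type*} [AddCommGroup V] [Module ℝ V] {T : V → V → V → V → ℝ}
    (hlin : ∀ X Y Z W W' (a : ℝ), T X Y Z (W - a • W') = T X Y Z W - a * T X Y Z W')
    (hrev : ∀ X Y Z W, T W Z Y X = T X Y Z W) (hswap : ∀ X Y Z W, T X Y Z W = -T Y X Z W)
    {φ : V → V} {ξ : V} {η : V → ℝ} (hφφ : ∀ X, φ (φ X) = -X + η X • ξ) (hφξ : φ ξ = 0) :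
    (∀ (a b c d : ℝ) (X Y Z W : V), T X Y Z W = T (φ X - a • ξ) (φ Y - b • ξ) Z W
        + T (φ X - a • ξ) Y (φ Z - c • ξ) W + T (φ X - a • ξ) Y Z (φ W - d • ξ))
      ↔ ∀ X Y Z W, T X Y Z W = T (φ X) Y Z (φ W) + T X (φ Y) Z (φ W) + T X Y (φ Z) (φ W) := by
  have hlin1 (X X' Y Z W : V) (a : ℝ) : T (X - a • X') Y Z W = T X Y Z W - a * T X' Y Z W := by
    rw [← hrev, hlin, hrev X Y Z W, hrev X' Y Z W]
  have hlin2 (X Y Y' Z W : V) (a : ℝ) : T X (Y - a • Y') Z W = T X Y Z W - a * T X Y' Z W := by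
    rw [hswap, hlin1, hswap X Y, hswap X Y']
    ring
  have hlin3 (X Y Z Z' W : V) (a : ℝ) : T X Y (Z - a • Z') W = T X Y Z W - a * T X Y Z' W := by
    rw [← hrev, hlin2, hrev X Y Z W, hrev X Y Z' W]
  have hzero (X Y Z : V) : T X Y Z 0 = 0 := by
    have := hlin X Y Z 0 0 1
    simp at this
    exact this
  have hall (h : ∀ X Y Z, T X Y Z ξ = 0) :
      (∀ Y Z W, T ξ Y Z W = 0) ∧ (∀ X Z W, T X ξ Z W = 0) ∧ ∀ X Y W, T X Y ξ W = 0 := by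
    have h1 (Y Z W : V) : T ξ Y Z W = 0 := by rw [← hrev, h]
    have h2 (X Z W : V) : T X ξ Z W = 0 := by rw [hswap, h1, neg_zero]
    exact ⟨h1, h2, fun X Y W => by rw [← hrev, h2]⟩
  constructor
  · intro hK
    have h1 (X Z W : V) : T (φ X) ξ Z W = 0 := by
      have e0 := hK 0 0 0 0 X 0 Z W
      have e1 := hK 0 1 0 0 X 0 Z W
      simp only [hlin1, hlin2, hlin3, hlin] at e0 e1
      linarith
    have h2 (Z W : V) : T ξ ξ Z W = 0 := by linarith [hswap ξ ξ Z W]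
    have h3 (X Z W : V) : T X ξ Z W = 0 := by
      have hX : X = ((0 : V) - (1 : ℝ) • φ (φ X)) - (-η X) • ξ := by
        rw [hφφ]
        module
      have h0 : T 0 ξ Z W = 0 := by rw [← hrev, hzero]
      rw [hX, hlin1, hlin1, h0, h1, h2]
      ring
    have h4 (X Y Z : V) : T X Y Z ξ = 0 := by rw [← hrev, hswap, h3, neg_zero]
    intro X Y Z W
    have e := hK 0 0 0 0 W Z Y X
    simp only [zero_smul, sub_zero] at e
    rw [hrev X Y Z W, hrev X (φ Y) Z (φ W), hrev X Y (φ Z) (φ W), hrev (φ X) Y Z (φ W)] at e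
    linarith
  · intro hG
    have h4 (X Y Z : V) : T X Y Z ξ = 0 := by
      rw [hG, hφξ]
      simp only [hzero, add_zero]
    obtain ⟨h1, h2, h3⟩ := hall h4
    intro a b c d X Y Z W
    have e := hG W Z Y X
    rw [hrev X Y Z W, hrev (φ X) Y Z (φ W), hrev (φ X) Y (φ Z) W, hrev (φ X) (φ Y) Z W] at e
    simp only [hlin1, hlin2, hlin3, hlin, h1, h2, h3, h4]
    linarith

variable {E : Type*} [NormedAddCommGroup E] [NormedSpace ℝ E]
  {H : Type*} [TopologicalSpace H] {I : ModelWithCorners ℝ E H}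
  {M : Type*} [TopologicalSpace M] [ChartedSpace H M] [IsManifold I ∞ M]

/-- The curvature of the metric cone over `M` at height `1`, restricted to vectors tangent to
`M`. -/
noncomputable def baseConeCurvature (g : RiemannianMetricOn I M) (x : M)
    (X Y Z W : TangentSpace I x) : ℝ :=
  riemannChristoffel g x X Y Z W + g.inner x Y Z * g.inner x X W - g.inner x X Z * g.inner x Y W

lemma baseConeCurvature_sub_smul (g : RiemannianMetricOn I M) (x : M)
    (X Y Z W W' : TangentSpace I x) (a : ℝ) :
    baseConeCurvature g x X Y Z (W - a • W')
      = baseConeCurvature g x X Y Z W - a * baseConeCurvature g x X Y Z W' := by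
  simp only [baseConeCurvature, riemannChristoffel, map_sub, map_smul, smul_eq_mul]
  ring

lemma AlmostContactMetricStructure.g_φ_left (S : AlmostContactMetricStructure I M) (x : M)
    (X Y : TangentSpace I x) : S.g.inner x (S.φ x X) Y = -S.g.inner x X (S.φ x Y) := by
  have h := S.g_φ_φ x X (S.φ x Y)
  rw [S.φ_φ, S.η_φ, map_add, map_neg, map_smul, S.g_ξ, S.η_φ, smul_zero] at h
  linarith

lemma AlmostContactMetricStructure.isG2_iff (S : AlmostContactMetricStructure I M) :
    S.IsG2 ↔ ∀ (x : M) (X Y Z W : TangentSpace I x),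
      baseConeCurvature S.g x X Y Z W
        = baseConeCurvature S.g x (S.φ x X) Y Z (S.φ x W)
          + baseConeCurvature S.g x X (S.φ x Y) Z (S.φ x W)
          + baseConeCurvature S.g x X Y (S.φ x Z) (S.φ x W) := by
  refine forall_congr' fun x => forall_congr' fun X => forall_congr' fun Y =>
    forall_congr' fun Z => forall_congr' fun W => ?_
  simp only [baseConeCurvature, S.g_φ_φ]
  rw [S.g_φ_left x X Z, S.g_φ_left x Y Z, S.g.symm x Z Y]
  constructor <;> intro h <;> linear_combination h

variable [I.Boundaryless] [FiniteDimensional ℝ E]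

lemma baseConeCurvature_reverse (g : RiemannianMetricOn I M) (x : M)
    (X Y Z W : TangentSpace I x) :
    baseConeCurvature g x W Z Y X = baseConeCurvature g x X Y Z W := by
  rw [baseConeCurvature, baseConeCurvature, riemannChristoffel_reverse, g.symm x Z Y,
    g.symm x W X, g.symm x W Y, g.symm x Z X]
  ring

lemma baseConeCurvature_swap (g : RiemannianMetricOn I M) (x : M)
    (X Y Z W : TangentSpace I x) :
    baseConeCurvature g x X Y Z W = -baseConeCurvature g x Y X Z W := by
  rw [baseConeCurvature, baseConeCurvature, riemannChristoffel_swap]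
  ring

lemma AlmostContactMetricStructure.isK2_cone_iff (S : AlmostContactMetricStructure I M) :
    S.cone.IsK2 ↔ ∀ (x : M) (a b c d : ℝ) (X Y Z W : TangentSpace I x),
      baseConeCurvature S.g x X Y Z W
        = baseConeCurvature S.g x (S.φ x X - a • S.ξ x) (S.φ x Y - b • S.ξ x) Z W
          + baseConeCurvature S.g x (S.φ x X - a • S.ξ x) Y (S.φ x Z - c • S.ξ x) W
          + baseConeCurvature S.g x (S.φ x X - a • S.ξ x) Y Z (S.φ x W - d • S.ξ x) := by
  have hR (p : ConeManifold M) (A B C D : TangentSpace (𝓘(ℝ, ℝ).prod I) p) :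
      riemannChristoffel S.cone.g p A B C D
        = (p.1 : ℝ) ^ 2 * baseConeCurvature S.g p.2 (coneProj I p A) (coneProj I p B)
          (coneProj I p C) (coneProj I p D) :=
    riemannChristoffel_coneMetric S.g p A B C D
  have hJ (p : ConeManifold M) (A : TangentSpace (𝓘(ℝ, ℝ).prod I) p) :
      coneProj I p (S.cone.J p A)
        = S.φ p.2 (coneProj I p A) - ((p.1 : ℝ)⁻¹ * coneDt I p A) • S.ξ p.2 := by
    rw [mul_smul]
    exact coneProj_coneJ S p A
  constructor
  · intro h x a b c d X Y Z W
    have e (p : ConeManifold M) (A B C D : TangentSpace (𝓘(ℝ, ℝ).prod I) p) := h p A B C D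
    simp only [hR, hJ] at e
    have e1 : (1 : ℝ) ^ 2 * baseConeCurvature S.g x X Y Z W
        = (1 : ℝ) ^ 2 * baseConeCurvature S.g x (S.φ x X - ((1 : ℝ)⁻¹ * a) • S.ξ x)
            (S.φ x Y - ((1 : ℝ)⁻¹ * b) • S.ξ x) Z W
          + (1 : ℝ) ^ 2 * baseConeCurvature S.g x (S.φ x X - ((1 : ℝ)⁻¹ * a) • S.ξ x) Y
            (S.φ x Z - ((1 : ℝ)⁻¹ * c) • S.ξ x) W
          + (1 : ℝ) ^ 2 * baseConeCurvature S.g x (S.φ x X - ((1 : ℝ)⁻¹ * a) • S.ξ x) Y Z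
            (S.φ x W - ((1 : ℝ)⁻¹ * d) • S.ξ x) :=
      e ((⟨1, Set.mem_Ioi.2 one_pos⟩ : PosReal), x) ((a, X) : ℝ × E) ((b, Y) : ℝ × E)
        ((c, Z) : ℝ × E) ((d, W) : ℝ × E)
    simpa only [inv_one, one_pow, one_mul] using e1
  · intro h p A B C D
    simp only [hR, hJ]
    rw [h p.2 ((p.1 : ℝ)⁻¹ * coneDt I p A) ((p.1 : ℝ)⁻¹ * coneDt I p B)
      ((p.1 : ℝ)⁻¹ * coneDt I p C) ((p.1 : ℝ)⁻¹ * coneDt I p D) (coneProj I p A)]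
    ring

end CurvatureIdentities

/-- The metric cone over an almost contact metric manifold, with its induced almost Hermitian
structure, satisfies `(K2)` if and only if the manifold satisfies `(G2)`. -/
theorem mainTheorem2
    {E : Type*} [NormedAddCommGroup E] [NormedSpace ℝ E] [FiniteDimensional ℝ E]
    {H : Type*} [TopologicalSpace H] {I : ModelWithCorners ℝ E H} [I.Boundaryless]
    {M : Type*} [TopologicalSpace M] [ChartedSpace H M] [IsManifold I ∞ M]
    (S : AlmostContactMetricStructure I M) :
    S.cone.IsK2 ↔ S.IsG2 := by
  rw [S.isK2_cone_iff, S.isG2_iff]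
  exact forall_congr' fun x => curvatureLike_K2_iff (baseConeCurvature_sub_smul S.g x)
    (baseConeCurvature_reverse S.g x) (baseConeCurvature_swap S.g x) (S.φ_φ x) (S.φ_ξ x)
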